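/- **Theorem (Cut elimination for $\mathbf{HE}$).** Formulas are built from propositional variables by $\neg$, $\to$, $\Box$, the conditional obligation $\bigcirc(B/A)$ and an auxiliary unary modality $\mathcal{B}et$. A sequent $\Gamma\Rightarrow\Delta$ is a pair of finite multisets of formulas; a hypersequent is a finite multiset of sequents (its components), written $\Gamma_1\Rightarrow\Delta_1\mid\dots\mid\Gamma_n\Rightarrow\Delta_n$. Write $\Gamma^{\Box}$ and $\Gamma^{O}$ for the sub-multisets of the formulas in $\Gamma$ of the form $\Box A$, respectively $\bigcirc(B/A)$, and $\Gamma^{b\downarrow}$ for the multiset of the $A$ with $\mathcal{B}et\,A$ in $\Gamma$. The calculus $\mathbf{HE}$ has the initial hypersequents $G\mid\Gamma,p\Rightarrow\Delta,p$ ($p$ a propositional variable) and the following rules, where $G$ is an arbitrary, possibly empty, hypersequent: * internal weakening and contraction, on the left and on the right, and the usual rules of $\mathbf{LK}$ for $\neg$ and $\to$, all applied to one component in the context $G$; * external weakening: from $G$ infer $G\mid\Gamma\Rightarrow\Delta$; external contraction: from $G\mid\Gamma\Rightarrow\Delta\mid\Gamma\Rightarrow\Delta$ infer $G\mid\Gamma\Rightarrow\Delta$;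 * $(s5')$: from $G\mid\Gamma^{\Box},\Gamma^{O},\Gamma'\Rightarrow\Delta'$ infer $G\mid\Gamma\Rightarrow\;\mid\Gamma'\Rightarrow\Delta'$; * $(\Box L)$: from $G\mid\Gamma,\Box A,A\Rightarrow\Delta$ infer $G\mid\Gamma,\Box A\Rightarrow\Delta$; $(\Box R)$: from $G\mid\Gamma^{\Box},\Gamma^{O}\Rightarrow A$ infer $G\mid\Gamma\Rightarrow\Delta,\Box A$; * $(\bigcirc L)$: from $G\mid\Gamma,\bigcirc(B/A)\Rightarrow\Delta,A$ and $G\mid\Gamma,\bigcirc(B/A)\Rightarrow\Delta,\mathcal{B}et\,\neg A$ and $G\mid\Gamma,\bigcirc(B/A),B\Rightarrow\Delta$ infer $G\mid\Gamma,\bigcirc(B/A)\Rightarrow\Delta$; $(\bigcirc R)$: from $G\mid\Gamma^{\Box},\Gamma^{O},A,\mathcal{B}et\,\neg A\Rightarrow B$ infer $G\mid\Gamma\Rightarrow\Delta,\bigcirc(B/A)$; * $(\mathcal{B}et)$: from $G\mid\Gamma^{\Box},\Gamma^{O},\Gamma^{b\downarrow}\Rightarrow A$ infer $G\mid\Gamma\Rightarrow\Delta,\mathcal{B}et\,A$.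 The rule (cut) infers $G\mid H\mid\Gamma,\Sigma\Rightarrow\Delta,\Pi$ from $G\mid\Gamma,A\Rightarrow\Delta$ and $H\mid\Sigma\Rightarrow\Pi,A$. Then: 1. Every hypersequent that has a proof in $\mathbf{HE}$ with the addition of (cut) has a proof in $\mathbf{HE}$ without (cut). 2. (Relaxed subformula property.) For every cut-free proof of a hypersequent $H$, every formula occurring in the proof is a subformula of a formula of $H$, or is $\neg C$ or $\mathcal{B}et\,\neg C$ for some conditional obligation $\bigcirc(D/C)$ that is a subformula of a formula of $H$. -/

import Mathlib

universe u

namespace HE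

/-- Formulas of the language with `¬`, `→`, `□`, `○(·/·)` extended by the auxiliary modality `Bet`,
over an arbitrary type `α` of propositional variables. -/
inductive Formula (α : Type u) : Type u
  | var (p : α)
  | neg (A : Formula α)
  | imp (A B : Formula α)
  | box (A : Formula α)
  /-- `obl B A` is `○(B/A)`: "`B` is obligatory, given `A`". -/
  | obl (B A : Formula α)
  | bet (A : Formula α)

namespace Formula

variable {α : Type u}

/-- The formula has the form `□A`. -/
def isBox : Formula α → Bool
  | box _ => true
  | _ => false

/-- The formula has the form `○(B/A)`. -/
def isObl : Formula α → Bool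
  | obl _ _ => true
  | _ => false

/-- `Bet A ↦ A`, undefined on formulas of any other form. -/
def unBet : Formula α → Option (Formula α)
  | bet A => some A
  | _ => none

/-- `IsSubformula B A`: `B` is a subformula of `A` (possibly `A` itself). -/
inductive IsSubformula (B : Formula α) : Formula α → Prop
  | refl : IsSubformula B B
  | neg {A : Formula α} : IsSubformula B A → IsSubformula B (neg A)
  | imp_left {A C : Formula α} : IsSubformula B A → IsSubformula B (imp A C)
  | imp_right {A C : Formula α} : IsSubformula B C → IsSubformula B (imp A C)
  | box {A : Formula α} : IsSubformula B A → IsSubformula B (box A)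
  | obl_left {A C : Formula α} : IsSubformula B A → IsSubformula B (obl A C)
  | obl_right {A C : Formula α} : IsSubformula B C → IsSubformula B (obl A C)
  | bet {A : Formula α} : IsSubformula B A → IsSubformula B (bet A)

/-- The relaxed subformulas of `A`: its subformulas, together with `¬C` and `Bet ¬C` for every
conditional obligation `○(D/C)` that is a subformula of `A`. -/
def IsRelaxedSubformula (B A : Formula α) : Prop :=
  IsSubformula B A ∨
    ∃ C D : Formula α, IsSubformula (obl D C) A ∧ (B = neg C ∨ B = bet (neg C))

end Formula

/-- `Γ^□`: the multiset of the boxed formulas of `Γ`. -/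
def boxPart {α : Type u} (Γ : Multiset (Formula α)) : Multiset (Formula α) :=
  Γ.filter (fun A => A.isBox = true)

/-- `Γ^O`: the multiset of the conditional obligations of `Γ`. -/
def oblPart {α : Type u} (Γ : Multiset (Formula α)) : Multiset (Formula α) :=
  Γ.filter (fun A => A.isObl = true)

/-- `Γ^{b↓}`: the multiset of the `A` such that `Bet A` is in `Γ`. -/
def betPart {α : Type u} (Γ : Multiset (Formula α)) : Multiset (Formula α) :=
  Γ.filterMap Formula.unBet

/-- Sequents: pairs of finite multisets of formulas. -/
structure Sequent (α : Type u) : Type u where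
  ant : Multiset (Formula α)
  suc : Multiset (Formula α)

/-- Hypersequents: finite multisets of sequents. -/
abbrev Hypersequent (α : Type u) : Type u := Multiset (Sequent α)

/-- `A` is a member of the antecedent or of the succedent of some component of `H`. -/
def Hypersequent.Contains {α : Type u} (H : Hypersequent α) (A : Formula α) : Prop :=
  ∃ S ∈ H, A ∈ S.ant ∨ A ∈ S.suc

end HE

infix:50 "⟹" => HE.Sequent.mk

namespace HE

open Formula

/-- Proofs (as finite trees) in the hypersequent calculus HE with the addition of the cut rule;
`Proof H` is the type of the proofs with end-hypersequent `H`. -/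
inductive Proof {α : Type u} : Hypersequent α → Type u
  -- initial hypersequents
  | ax (p : α) (Γ Δ : Multiset (Formula α)) (G : Hypersequent α) :
      Proof ((var p ::ₘ Γ ⟹ var p ::ₘ Δ) ::ₘ G)
  -- internal structural rules
  | weakL {A : Formula α} {Γ Δ : Multiset (Formula α)} {G : Hypersequent α} :
      Proof ((Γ ⟹ Δ) ::ₘ G) → Proof ((A ::ₘ Γ ⟹ Δ) ::ₘ G)
  | weakR {A : Formula α} {Γ Δ : Multiset (Formula α)} {G : Hypersequent α} :
      Proof ((Γ ⟹ Δ) ::ₘ G) → Proof ((Γ ⟹ A ::ₘ Δ) ::ₘ G)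
  | contrL {A : Formula α} {Γ Δ : Multiset (Formula α)} {G : Hypersequent α} :
      Proof ((A ::ₘ A ::ₘ Γ ⟹ Δ) ::ₘ G) → Proof ((A ::ₘ Γ ⟹ Δ) ::ₘ G)
  | contrR {A : Formula α} {Γ Δ : Multiset (Formula α)} {G : Hypersequent α} :
      Proof ((Γ ⟹ A ::ₘ A ::ₘ Δ) ::ₘ G) → Proof ((Γ ⟹ A ::ₘ Δ) ::ₘ G)
  -- propositional rules
  | negL {A : Formula α} {Γ Δ : Multiset (Formula α)} {G : Hypersequent α} :
      Proof ((Γ ⟹ A ::ₘ Δ) ::ₘ G) → Proof ((neg A ::ₘ Γ ⟹ Δ) ::ₘ G)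
  | negR {A : Formula α} {Γ Δ : Multiset (Formula α)} {G : Hypersequent α} :
      Proof ((A ::ₘ Γ ⟹ Δ) ::ₘ G) → Proof ((Γ ⟹ neg A ::ₘ Δ) ::ₘ G)
  | impL {A B : Formula α} {Γ Δ : Multiset (Formula α)} {G : Hypersequent α} :
      Proof ((Γ ⟹ A ::ₘ Δ) ::ₘ G) → Proof ((B ::ₘ Γ ⟹ Δ) ::ₘ G) →
        Proof ((imp A B ::ₘ Γ ⟹ Δ) ::ₘ G)
  | impR {A B : Formula α} {Γ Δ : Multiset (Formula α)} {G : Hypersequent α} :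
      Proof ((A ::ₘ Γ ⟹ B ::ₘ Δ) ::ₘ G) → Proof ((Γ ⟹ imp A B ::ₘ Δ) ::ₘ G)
  -- external structural rules
  | ew {Γ Δ : Multiset (Formula α)} {G : Hypersequent α} :
      Proof G → Proof ((Γ ⟹ Δ) ::ₘ G)
  | ec {Γ Δ : Multiset (Formula α)} {G : Hypersequent α} :
      Proof ((Γ ⟹ Δ) ::ₘ (Γ ⟹ Δ) ::ₘ G) → Proof ((Γ ⟹ Δ) ::ₘ G)
  | s5 {Γ Γ' Δ' : Multiset (Formula α)} {G : Hypersequent α} :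
      Proof ((boxPart Γ + oblPart Γ + Γ' ⟹ Δ') ::ₘ G) →
        Proof ((Γ ⟹ 0) ::ₘ (Γ' ⟹ Δ') ::ₘ G)
  -- modal and deontic rules
  | boxL {A : Formula α} {Γ Δ : Multiset (Formula α)} {G : Hypersequent α} :
      Proof ((A ::ₘ box A ::ₘ Γ ⟹ Δ) ::ₘ G) → Proof ((box A ::ₘ Γ ⟹ Δ) ::ₘ G)
  | boxR {A : Formula α} {Γ Δ : Multiset (Formula α)} {G : Hypersequent α} :
      Proof ((boxPart Γ + oblPart Γ ⟹ {A}) ::ₘ G) → Proof ((Γ ⟹ box A ::ₘ Δ) ::ₘ G)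
  | oblL {A B : Formula α} {Γ Δ : Multiset (Formula α)} {G : Hypersequent α} :
      Proof ((obl B A ::ₘ Γ ⟹ A ::ₘ Δ) ::ₘ G) →
      Proof ((obl B A ::ₘ Γ ⟹ bet (neg A) ::ₘ Δ) ::ₘ G) →
      Proof ((B ::ₘ obl B A ::ₘ Γ ⟹ Δ) ::ₘ G) →
        Proof ((obl B A ::ₘ Γ ⟹ Δ) ::ₘ G)
  | oblR {A B : Formula α} {Γ Δ : Multiset (Formula α)} {G : Hypersequent α} :
      Proof ((A ::ₘ bet (neg A) ::ₘ (boxPart Γ + oblPart Γ) ⟹ {B}) ::ₘ G) →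
        Proof ((Γ ⟹ obl B A ::ₘ Δ) ::ₘ G)
  | betR {A : Formula α} {Γ Δ : Multiset (Formula α)} {G : Hypersequent α} :
      Proof ((boxPart Γ + oblPart Γ + betPart Γ ⟹ {A}) ::ₘ G) →
        Proof ((Γ ⟹ bet A ::ₘ Δ) ::ₘ G)
  -- the cut rule
  | cut {A : Formula α} {Γ Δ Γ' Δ' : Multiset (Formula α)} {G H : Hypersequent α} :
      Proof ((A ::ₘ Γ ⟹ Δ) ::ₘ G) → Proof ((Γ' ⟹ A ::ₘ Δ') ::ₘ H) →
        Proof ((Γ + Γ' ⟹ Δ + Δ') ::ₘ (G + H))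

/-- The proof contains no application of the cut rule, i.e. it is a proof in HE itself. -/
def Proof.CutFree {α : Type u} {H : Hypersequent α} : Proof H → Prop
  | .ax _ _ _ _ => True
  | .weakL d | .weakR d | .contrL d | .contrR d
  | .negL d | .negR d | .impR d
  | .ew d | .ec d | .s5 d
  | .boxL d | .boxR d | .oblR d | .betR d => d.CutFree
  | .impL d₁ d₂ => d₁.CutFree ∧ d₂.CutFree
  | .oblL d₁ d₂ d₃ => d₁.CutFree ∧ d₂.CutFree ∧ d₃.CutFree
  | .cut _ _ => False

/-- The end-hypersequent of a proof. -/
def Proof.conclusion {α : Type u} {H : Hypersequent α} (_ : Proof H) : Hypersequent α := H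

/-- The formula `A` occurs in the proof: it is contained in the end-hypersequent or
occurs in one of the subproofs of the premises of the last rule. -/
def Proof.Occurs {α : Type u} (A : Formula α) {H : Hypersequent α} : Proof H → Prop
  | e@(.ax _ _ _ _) => e.conclusion.Contains A
  | e@(.weakL d) | e@(.weakR d) | e@(.contrL d) | e@(.contrR d)
  | e@(.negL d) | e@(.negR d) | e@(.impR d)
  | e@(.ew d) | e@(.ec d) | e@(.s5 d)
  | e@(.boxL d) | e@(.boxR d) | e@(.oblR d) | e@(.betR d) =>
      e.conclusion.Contains A ∨ d.Occurs A
  | e@(.impL d₁ d₂) | e@(.cut d₁ d₂) =>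
      e.conclusion.Contains A ∨ d₁.Occurs A ∨ d₂.Occurs A
  | e@(.oblL d₁ d₂ d₃) =>
      e.conclusion.Contains A ∨ d₁.Occurs A ∨ d₂.Occurs A ∨ d₃.Occurs A

end HE

/-!
Cut is eliminated semantically. Say that a preference model refutes a hypersequent if each component
fails at some world. Every rule, cut included, passes a refutation of its conclusion on to one of
its premises, so no provable hypersequent is refuted. Conversely, if `H` has no cut-free proof, the
set of its components extends to a maximal set `K` of sequents none of whose hypersequents is
cut-free provable, and the maximal sets of signed formulas all of whose finite parts lie in `K` are
the worlds of a model refuting `H`. Each rule of the calculus is one clause of the truth lemma;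
external contraction makes sequents of `K` reusable, and `(s5')` makes `□` and `○` global.
-/

universe v

namespace HE

open Formula

variable {α : Type u} {A B C : Formula α} {Γ Δ : Multiset (Formula α)}
  {S T : Sequent α} {G H : Hypersequent α}

theorem forall_mem_add {β : Type*} {s t : Multiset β} {p : β → Prop} :
    (∀ b ∈ s + t, p b) ↔ (∀ b ∈ s, p b) ∧ ∀ b ∈ t, p b := by
  simp only [Multiset.mem_add, or_imp, forall_and]

theorem mem_boxPart_add_oblPart :
    A ∈ boxPart Γ + oblPart Γ ↔ A ∈ Γ ∧ (A.isBox = true ∨ A.isObl = true) := by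
  simp only [boxPart, oblPart, Multiset.mem_add, Multiset.mem_filter, and_or_left]

theorem mem_betPart : A ∈ betPart Γ ↔ bet A ∈ Γ := by
  refine (Multiset.mem_filterMap unBet Γ).trans ⟨?_, fun h => ⟨_, h, rfl⟩⟩
  rintro ⟨B, hB, hBA⟩
  cases B with
  | bet B => exact Option.some.inj hBA ▸ hB
  | _ => cases hBA

/-! ### Relaxed subformulas -/

theorem Formula.IsSubformula.trans (hAB : IsSubformula A B) (hBC : IsSubformula B C) :
    IsSubformula A C := by
  induction hBC with
  | refl => exact hAB
  | neg _ ih => exact .neg ih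
  | imp_left _ ih => exact .imp_left ih
  | imp_right _ ih => exact .imp_right ih
  | box _ ih => exact .box ih
  | obl_left _ ih => exact .obl_left ih
  | obl_right _ ih => exact .obl_right ih
  | bet _ ih => exact .bet ih

/-- A set of formulas closed under passing from the principal formula of a rule of `HE` to the
active formulas of its premises. -/
structure RelaxedClosed (X : Set (Formula α)) : Prop where
  neg {A : Formula α} : neg A ∈ X → A ∈ X
  imp_left {A B : Formula α} : imp A B ∈ X → A ∈ X
  imp_right {A B : Formula α} : imp A B ∈ X → B ∈ X
  box {A : Formula α} : box A ∈ X → A ∈ X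
  obl_left {A B : Formula α} : obl B A ∈ X → B ∈ X
  obl_right {A B : Formula α} : obl B A ∈ X → A ∈ X
  obl_bet {A B : Formula α} : obl B A ∈ X → bet (.neg A) ∈ X
  bet {A : Formula α} : bet A ∈ X → A ∈ X

theorem Formula.IsRelaxedSubformula.isSubformula (h : IsRelaxedSubformula A B)
    (hneg : ∀ C, A ≠ neg C) (hbet : ∀ C, A ≠ bet C) : IsSubformula A B := by
  rcases h with h | ⟨C, _, _, h | h⟩
  · exact h
  · exact (hneg C h).elim
  · exact (hbet _ h).elim

theorem Formula.IsRelaxedSubformula.of_neg (h : IsRelaxedSubformula (neg A) B) :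
    IsRelaxedSubformula A B := by
  rcases h with h | ⟨C, D, hCD, h | h⟩
  · exact .inl (.trans (.neg .refl) h)
  · cases h
    exact .inl (.trans (.obl_right .refl) hCD)
  · cases h

theorem Formula.IsRelaxedSubformula.of_bet (h : IsRelaxedSubformula (bet A) B) :
    IsRelaxedSubformula A B := by
  rcases h with h | ⟨C, D, hCD, h | h⟩
  · exact .inl (.trans (.bet .refl) h)
  · cases h
  · cases h
    exact .inr ⟨C, D, hCD, .inl rfl⟩

theorem relaxedClosed_setOf_isRelaxedSubformula (Y : Set (Formula α)) :
    RelaxedClosed {B | ∃ A ∈ Y, IsRelaxedSubformula B A} where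
  neg := fun ⟨D, hD, h⟩ => ⟨D, hD, h.of_neg⟩
  imp_left := fun ⟨D, hD, h⟩ =>
    ⟨D, hD, .inl (.trans (.imp_left .refl) (h.isSubformula nofun nofun))⟩
  imp_right := fun ⟨D, hD, h⟩ =>
    ⟨D, hD, .inl (.trans (.imp_right .refl) (h.isSubformula nofun nofun))⟩
  box := fun ⟨D, hD, h⟩ => ⟨D, hD, .inl (.trans (.box .refl) (h.isSubformula nofun nofun))⟩
  obl_left := fun ⟨D, hD, h⟩ =>
    ⟨D, hD, .inl (.trans (.obl_left .refl) (h.isSubformula nofun nofun))⟩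
  obl_right := fun ⟨D, hD, h⟩ =>
    ⟨D, hD, .inl (.trans (.obl_right .refl) (h.isSubformula nofun nofun))⟩
  obl_bet := fun ⟨D, hD, h⟩ => ⟨D, hD, .inr ⟨_, _, h.isSubformula nofun nofun, .inr rfl⟩⟩
  bet := fun ⟨D, hD, h⟩ => ⟨D, hD, h.of_bet⟩

/-- All formulas of the hypersequent lie in `X`. -/
def Hypersequent.Within (H : Hypersequent α) (X : Set (Formula α)) : Prop :=
  ∀ A, H.Contains A → A ∈ X

theorem Hypersequent.within_cons {X : Set (Formula α)} :
    Within ((Γ ⟹ Δ) ::ₘ G) X ↔ ((∀ A ∈ Γ, A ∈ X) ∧ ∀ A ∈ Δ, A ∈ X) ∧ Within G X := by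
  simp only [Within, Contains, Multiset.mem_cons, or_and_right, exists_or, exists_eq_left, or_imp,
    forall_and]

theorem Proof.CutFree.mem_of_occurs {X : Set (Formula α)} (hX : RelaxedClosed X)
    {d : Proof H} (hd : d.CutFree) (hH : H.Within X) (hB : d.Occurs B) : B ∈ X := by
  induction d with
  | cut => exact hd.elim
  | ax => exact hH B hB
  | ew _ ih => exact hB.elim (hH B) (ih hd (Hypersequent.within_cons.1 hH).2)
  | weakL _ ih | weakR _ ih | contrL _ ih | contrR _ ih | negL _ ih | negR _ ih | impR _ ih
  | ec _ ih | s5 _ ih | boxL _ ih | boxR _ ih | oblR _ ih | betR _ ih =>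
    refine hB.elim (hH B) (ih hd ?_)
    simp only [Hypersequent.within_cons, Multiset.forall_mem_cons, Multiset.mem_singleton,
      forall_eq, Multiset.mem_add (s := _ + _), mem_boxPart_add_oblPart, mem_betPart] at hH ⊢
    grind only [RelaxedClosed]
  | impL _ _ ih₁ ih₂ =>
    refine hB.elim (hH B) (Or.rec (ih₁ hd.1 ?_) (ih₂ hd.2 ?_)) <;>
      simp only [Hypersequent.within_cons, Multiset.forall_mem_cons] at hH ⊢
    · exact ⟨⟨hH.1.1.2, hX.imp_left hH.1.1.1, hH.1.2⟩, hH.2⟩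
    · exact ⟨⟨⟨hX.imp_right hH.1.1.1, hH.1.1.2⟩, hH.1.2⟩, hH.2⟩
  | oblL _ _ _ ih₁ ih₂ ih₃ =>
    refine hB.elim (hH B) (Or.rec (ih₁ hd.1 ?_) (Or.rec (ih₂ hd.2.1 ?_) (ih₃ hd.2.2 ?_))) <;>
      simp only [Hypersequent.within_cons, Multiset.forall_mem_cons] at hH ⊢
    · exact ⟨⟨hH.1.1, hX.obl_right hH.1.1.1, hH.1.2⟩, hH.2⟩
    · exact ⟨⟨hH.1.1, hX.obl_bet hH.1.1.1, hH.1.2⟩, hH.2⟩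
    · exact ⟨⟨⟨hX.obl_left hH.1.1.1, hH.1.1⟩, hH.1.2⟩, hH.2⟩

/-! ### Preference models -/

/-- A formula prefixed with the side of a sequent it stands on: `holds A` for an antecedent formula
and `fails A` for a succedent formula. Sets of signed formulas play the role of infinite sequents,
and of the theories of the worlds of a model. -/
inductive SignedFormula (α : Type u) : Type u
  | holds (A : Formula α)
  | fails (A : Formula α)

open SignedFormula

/-- The finite set of signed formulas that a sequent stands for: its antecedent formulas hold and
its succedent formulas fail. Multiplicities are lost, which is harmless by internal contraction. -/
def Sequent.signed (S : Sequent α) : Set (SignedFormula α) :=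
  holds '' {A | A ∈ S.ant} ∪ fails '' {A | A ∈ S.suc}

namespace Sequent

variable {t : Set (SignedFormula α)}

@[simp]
theorem holds_mem_signed : holds A ∈ S.signed ↔ A ∈ S.ant := by
  simp [signed]

@[simp]
theorem fails_mem_signed : fails A ∈ S.signed ↔ A ∈ S.suc := by
  simp [signed]

theorem signed_subset_iff :
    S.signed ⊆ t ↔ (∀ A ∈ S.ant, holds A ∈ t) ∧ ∀ A ∈ S.suc, fails A ∈ t := by
  rw [signed, Set.union_subset_iff, Set.image_subset_iff, Set.image_subset_iff]
  exact .rfl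

end Sequent

/-- A preference model for `HE`: `better w v` says that `v` is better than `w`. No property of the
betterness relation is required. -/
structure Model (α : Type u) : Type (max u (v + 1)) where
  World : Type v
  better : World → World → Prop
  val : World → α → Prop

namespace Model

/-- Truth at a world: `□` is the universal modality, `bet A` says that `A` holds at all better
worlds, and `○(B/A)` says that `B` holds at all best `A`-worlds, i.e. at the `A`-worlds `v` at which
`bet (neg A)` is true. -/
def Sat (M : Model.{u, v} α) : M.World → Formula α → Prop
  | w, var p => M.val w p
  | w, neg A => ¬ M.Sat w A
  | w, imp A B => M.Sat w A → M.Sat w B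
  | _, box A => ∀ v, M.Sat v A
  | _, obl B A => ∀ v, M.Sat v A → (∀ u, M.better v u → ¬ M.Sat u A) → M.Sat v B
  | w, bet A => ∀ v, M.better w v → M.Sat v A

variable (M : Model.{u, v} α)

/-- The set of the signed formulas that are correct at the world `w`. -/
def theory (w : M.World) : Set (SignedFormula α) :=
  holds '' {A | M.Sat w A} ∪ fails '' {A | ¬ M.Sat w A}

/-- Every component of the hypersequent is false at some world, not necessarily the same one. -/
def Refutes (H : Hypersequent α) : Prop :=
  ∀ S ∈ H, ∃ w, S.signed ⊆ M.theory w

variable {M}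

theorem holds_mem_theory {w : M.World} : holds A ∈ M.theory w ↔ M.Sat w A := by
  simp [theory]

theorem fails_mem_theory {w : M.World} : fails A ∈ M.theory w ↔ ¬ M.Sat w A := by
  simp [theory]

theorem not_sat_bet {w : M.World} :
    ¬ M.Sat w (bet A) ↔ ∃ v, M.better w v ∧ ¬ M.Sat v A := by
  simp [Sat]

theorem not_sat_obl {w : M.World} :
    ¬ M.Sat w (obl B A) ↔ ∃ v, M.Sat v A ∧ M.Sat v (bet (neg A)) ∧ ¬ M.Sat v B := by
  simp [Sat]

theorem not_sat_or_not_sat_bet_or_sat_of_sat_obl {w : M.World} (h : M.Sat w (obl B A)) :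
    ¬ M.Sat w A ∨ ¬ M.Sat w (bet (neg A)) ∨ M.Sat w B := by
  by_contra! hw
  exact hw.2.2 (h w hw.1 hw.2.1)

theorem refutes_cons : M.Refutes ((Γ ⟹ Δ) ::ₘ G) ↔
    (∃ w, (∀ A ∈ Γ, M.Sat w A) ∧ ∀ A ∈ Δ, ¬ M.Sat w A) ∧ M.Refutes G := by
  simp only [Refutes, Multiset.forall_mem_cons, Sequent.signed_subset_iff,
    holds_mem_theory, fails_mem_theory]

theorem refutes_add : M.Refutes (G + H) ↔ M.Refutes G ∧ M.Refutes H :=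
  forall_mem_add

theorem sat_of_mem_boxPart_add_oblPart {w : M.World} (h : ∀ A ∈ Γ, M.Sat w A) (v : M.World) :
    ∀ A ∈ boxPart Γ + oblPart Γ, M.Sat v A := by
  intro A hA
  obtain ⟨hAΓ, hA⟩ := mem_boxPart_add_oblPart.1 hA
  have hw := h A hAΓ
  cases A with
  | box A => exact hw
  | obl B A => exact hw
  | _ => simp only [isBox, isObl, Bool.false_eq_true, or_self] at hA

end Model

open Model

theorem Proof.not_refutes (d : Proof H) (M : Model.{u, v} α) : ¬ M.Refutes H := by
  induction d with (intro hH; simp only [refutes_cons, refutes_add, Multiset.forall_mem_cons,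
      Multiset.mem_singleton, forall_eq] at *)
  | ew _ ih => exact ih hH.2
  | ec _ ih => exact ih ⟨hH.1, hH⟩
  | ax =>
    obtain ⟨⟨w, hΓ, hΔ⟩, -⟩ := hH
    exact hΔ.1 hΓ.1
  | weakL _ ih | weakR _ ih | contrL _ ih | contrR _ ih | negL _ ih | negR _ ih | impR _ ih
  | boxL _ ih =>
    obtain ⟨⟨w, hΓ, hΔ⟩, hG⟩ := hH
    refine ih ⟨⟨w, ?_⟩, hG⟩
    grind [Sat]
  | @impL A B Γ Δ G _ _ ih₁ ih₂ =>
    obtain ⟨⟨w, hΓ, hΔ⟩, hG⟩ := hH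
    by_cases hA : M.Sat w A
    · exact ih₂ ⟨⟨w, ⟨hΓ.1 hA, hΓ.2⟩, hΔ⟩, hG⟩
    · exact ih₁ ⟨⟨w, hΓ.2, hA, hΔ⟩, hG⟩
  | oblL _ _ _ ih₁ ih₂ ih₃ =>
    obtain ⟨⟨w, hΓ, hΔ⟩, hG⟩ := hH
    rcases not_sat_or_not_sat_bet_or_sat_of_sat_obl hΓ.1 with hA | hbet | hB
    · exact ih₁ ⟨⟨w, hΓ, hA, hΔ⟩, hG⟩
    · exact ih₂ ⟨⟨w, hΓ, hbet, hΔ⟩, hG⟩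
    · exact ih₃ ⟨⟨w, ⟨hB, hΓ⟩, hΔ⟩, hG⟩
  | s5 _ ih =>
    obtain ⟨⟨w, hΓ, -⟩, ⟨v, hΓ', hΔ'⟩, hG⟩ := hH
    exact ih ⟨⟨v, forall_mem_add.2 ⟨sat_of_mem_boxPart_add_oblPart hΓ v, hΓ'⟩, hΔ'⟩, hG⟩
  | boxR _ ih =>
    obtain ⟨⟨w, hΓ, hΔ⟩, hG⟩ := hH
    obtain ⟨v, hA⟩ := not_forall.1 hΔ.1
    exact ih ⟨⟨v, sat_of_mem_boxPart_add_oblPart hΓ v, hA⟩, hG⟩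
  | oblR _ ih =>
    obtain ⟨⟨w, hΓ, hΔ⟩, hG⟩ := hH
    obtain ⟨v, hA, hbest, hB⟩ := not_sat_obl.1 hΔ.1
    exact ih ⟨⟨v, ⟨hA, hbest, sat_of_mem_boxPart_add_oblPart hΓ v⟩, hB⟩, hG⟩
  | @betR A Γ Δ G _ ih =>
    obtain ⟨⟨w, hΓ, hΔ⟩, hG⟩ := hH
    obtain ⟨v, hwv, hA⟩ := not_sat_bet.1 hΔ.1
    have hbet : ∀ B ∈ betPart Γ, M.Sat v B := fun B hB => hΓ (bet B) (mem_betPart.1 hB) v hwv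
    exact ih ⟨⟨v, forall_mem_add.2 ⟨sat_of_mem_boxPart_add_oblPart hΓ v, hbet⟩, hA⟩, hG⟩
  | @cut A Γ Δ Γ' Δ' G H _ _ ih₁ ih₂ =>
    obtain ⟨⟨w, hΓ, hΔ⟩, hG, hH⟩ := hH
    rw [forall_mem_add] at hΓ hΔ
    by_cases hA : M.Sat w A
    · exact ih₁ ⟨⟨w, ⟨hA, hΓ.1⟩, hΔ.1⟩, hG⟩
    · exact ih₂ ⟨⟨w, hΓ.2, hA, hΔ.2⟩, hH⟩

/-! ### Cut-free provability -/

/-- Provability in `HE` itself, i.e. without cut. -/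
def Provable (H : Hypersequent α) : Prop :=
  ∃ d : Proof H, d.CutFree

theorem of_subset_of_weakening_of_contraction {β : Type*} {P : Multiset β → Prop}
    (weak : ∀ b s, P s → P (b ::ₘ s)) (contr : ∀ b s, P (b ::ₘ b ::ₘ s) → P (b ::ₘ s))
    {s t : Multiset β} (hst : s ⊆ t) (hs : P s) : P t := by
  have weaken_add : ∀ t, P (t + s) := by
    intro t
    induction t using Multiset.induction with
    | empty => rwa [zero_add]
    | cons b t ih => exact Multiset.cons_add b t s ▸ weak b _ ih
  have contract_add : ∀ s ⊆ t, P (s + t) → P t := by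
    intro s
    induction s using Multiset.induction with
    | empty => exact fun _ h => zero_add t ▸ h
    | cons b s ih =>
      intro hs h
      obtain ⟨hb, hs⟩ := Multiset.cons_subset.1 hs
      obtain ⟨t, rfl⟩ := Multiset.exists_cons_of_mem hb
      rw [Multiset.cons_add, Multiset.add_cons] at h
      exact ih hs (Multiset.add_cons b s t ▸ contr b _ h)
  exact contract_add s hst (add_comm t s ▸ weaken_add t)

theorem Provable.mono (hGH : G ⊆ H) (hG : Provable G) : Provable H :=
  of_subset_of_weakening_of_contraction (P := Provable) (fun _ _ ⟨d, h⟩ => ⟨.ew d, h⟩)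
    (fun _ _ ⟨d, h⟩ => ⟨.ec d, h⟩) hGH hG

theorem Provable.mono_cons (hST : S.signed ⊆ T.signed) (hGH : G ⊆ H) (h : Provable (S ::ₘ G)) :
    Provable (T ::ₘ H) := by
  simp only [Sequent.signed_subset_iff, Sequent.holds_mem_signed, Sequent.fails_mem_signed] at hST
  obtain ⟨hant, hsuc⟩ := hST
  have hL : Provable ((T.ant ⟹ S.suc) ::ₘ G) :=
    of_subset_of_weakening_of_contraction (P := fun Γ => Provable ((Γ ⟹ S.suc) ::ₘ G))
      (fun _ _ ⟨d, h⟩ => ⟨.weakL d, h⟩) (fun _ _ ⟨d, h⟩ => ⟨.contrL d, h⟩) hant h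
  have hLR : Provable (T ::ₘ G) :=
    of_subset_of_weakening_of_contraction (P := fun Δ => Provable ((T.ant ⟹ Δ) ::ₘ G))
      (fun _ _ ⟨d, h⟩ => ⟨.weakR d, h⟩) (fun _ _ ⟨d, h⟩ => ⟨.contrR d, h⟩) hsuc hL
  exact hLR.mono (Multiset.cons_subset_cons hGH)

/-- Adds a signed formula to the side of the sequent on which it belongs. -/
def Sequent.cons (f : SignedFormula α) (S : Sequent α) : Sequent α :=
  match f with
  | holds A => A ::ₘ S.ant ⟹ S.suc
  | fails A => S.ant ⟹ A ::ₘ S.suc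

namespace Sequent

variable {f : SignedFormula α} {t : Set (SignedFormula α)}

theorem signed_cons : (S.cons f).signed = insert f S.signed := by
  cases f <;> ext g <;> cases g <;> simp [cons, signed]

theorem finite_signed (S : Sequent α) : S.signed.Finite :=
  ((Multiset.finite_toSet S.ant).image holds).union
    ((Multiset.finite_toSet S.suc).image fails)

theorem exists_signed_subset_insert (hS : S.signed ⊆ insert f t) :
    ∃ S' : Sequent α, S'.signed ⊆ t ∧ S.signed ⊆ insert f S'.signed := by
  classical
  refine ⟨S.ant.filter (holds · ∈ t) ⟹ S.suc.filter (fails · ∈ t), ?_, ?_⟩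
  all_goals simp only [signed_subset_iff, Multiset.mem_filter] at hS ⊢
  · exact ⟨fun A hA => hA.2, fun A hA => hA.2⟩
  · exact ⟨fun A hA => (hS.1 A hA).imp_right fun h => by simp [signed, hA, h],
      fun A hA => (hS.2 A hA).imp_right fun h => by simp [signed, hA, h]⟩

end Sequent

/-! ### The canonical model -/

variable {K : Set (Sequent α)} {w : Set (SignedFormula α)} {f : SignedFormula α}

/-- No hypersequent with components in `K` has a cut-free proof. -/
def Consistent (K : Set (Sequent α)) : Prop :=
  ∀ G : Hypersequent α, (∀ S ∈ G, S ∈ K) → ¬ Provable G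

theorem Consistent.exists_maximal (hK : Consistent K) : ∃ K', K ⊆ K' ∧ Maximal Consistent K' := by
  have finiteCharacter : Order.IsOfFiniteCharacter {K : Set (Sequent α) | Consistent K} :=
    fun K => ⟨fun hK L hLK _ G hG => hK G fun S hS => hLK (hG S hS),
      fun h G hG => h _ hG (Multiset.finite_toSet G) G fun _ => id⟩
  exact finiteCharacter.exists_maximal hK

theorem exists_provable_cons_of_notMem (hK : Maximal Consistent K) (hS : S ∉ K) :
    ∃ G : Hypersequent α, (∀ T ∈ G, T ∈ K) ∧ Provable (S ::ₘ G) := by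
  classical
  have hinsert : ¬ Consistent (insert S K) := fun h =>
    hS (hK.le_of_ge h (Set.subset_insert S K) (Set.mem_insert S K))
  simp only [Consistent, not_forall, not_not] at hinsert
  obtain ⟨G, hG, hGprov⟩ := hinsert
  refine ⟨G.filter (· ∈ K), fun T hT => (Multiset.mem_filter.1 hT).2, hGprov.mono fun T hT => ?_⟩
  rw [Multiset.mem_cons, Multiset.mem_filter]
  exact (hG T hT).imp_right fun h => ⟨hT, h⟩

theorem not_provable_cons (hK : Consistent K) (hS : S ∈ K) (hG : ∀ T ∈ G, T ∈ K) :
    ¬ Provable (S ::ₘ G) :=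
  hK _ (Multiset.forall_mem_cons.2 ⟨hS, hG⟩)

/-- All the finite parts of `w`, regarded as an infinite sequent, lie in `K`. -/
def Coherent (K : Set (Sequent α)) (w : Set (SignedFormula α)) : Prop :=
  ∀ S : Sequent α, S.signed ⊆ w → S ∈ K

/-- The worlds of the canonical model: the maximal coherent sets of signed formulas. -/
def World (K : Set (Sequent α)) : Type u :=
  {w : Set (SignedFormula α) // Maximal (Coherent K) w}

theorem Coherent.exists_world (hw : Coherent K w) : ∃ v : World K, w ⊆ v.1 := by
  have finiteCharacter : Order.IsOfFiniteCharacter {w : Set (SignedFormula α) | Coherent K w} :=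
    fun w => ⟨fun hw v hvw _ S hS => hw S (hS.trans hvw),
      fun h S hS => h _ hS S.finite_signed S subset_rfl⟩
  obtain ⟨v, hwv, hv⟩ := finiteCharacter.exists_maximal hw
  exact ⟨⟨v, hv⟩, hwv⟩

theorem coherent_signed (hK : Maximal Consistent K) (hS : S ∈ K) : Coherent K S.signed := by
  intro T hTS
  by_contra hT
  obtain ⟨G, hG, hTG⟩ := exists_provable_cons_of_notMem hK hT
  exact not_provable_cons hK.prop hS hG (hTG.mono_cons hTS (Multiset.Subset.refl G))

theorem exists_world_of_rule (hK : Maximal Consistent K) (w : World K) {t : Set (SignedFormula α)}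
    (rule : ∀ S G, S.signed ⊆ t → Provable (S ::ₘ G) → ∃ T, T.signed ⊆ w.1 ∧ Provable (T ::ₘ G)) :
    ∃ v : World K, t ⊆ v.1 := by
  refine Coherent.exists_world fun S hSt => ?_
  by_contra hS
  obtain ⟨G, hG, hSG⟩ := exists_provable_cons_of_notMem hK hS
  obtain ⟨T, hTw, hTG⟩ := rule S G hSt hSG
  exact not_provable_cons hK.prop (w.2.prop T hTw) hG hTG

namespace World

variable {w v : World K}

theorem exists_provable_cons (hK : Maximal Consistent K) (hf : f ∉ w.1) :
    ∃ (S : Sequent α) (G : Hypersequent α),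
      S.signed ⊆ w.1 ∧ (∀ T ∈ G, T ∈ K) ∧ Provable (S.cons f ::ₘ G) := by
  have hinsert : ¬ Coherent K (insert f w.1) := fun h =>
    hf (w.2.le_of_ge h (Set.subset_insert f w.1) (Set.mem_insert f w.1))
  simp only [Coherent, not_forall] at hinsert
  obtain ⟨T, hTf, hT⟩ := hinsert
  obtain ⟨G, hG, hTG⟩ := exists_provable_cons_of_notMem hK hT
  obtain ⟨S, hS, hTS⟩ := Sequent.exists_signed_subset_insert hTf
  exact ⟨S, G, hS, hG, hTG.mono_cons (Sequent.signed_cons ▸ hTS) (Multiset.Subset.refl G)⟩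

theorem exists_forall_provable_cons (hK : Maximal Consistent K) {F : List (SignedFormula α)}
    (hF : ∀ f ∈ F, f ∉ w.1) :
    ∃ (S : Sequent α) (G : Hypersequent α),
      S.signed ⊆ w.1 ∧ (∀ T ∈ G, T ∈ K) ∧ ∀ f ∈ F, Provable (S.cons f ::ₘ G) := by
  induction F with
  | nil => exact ⟨0 ⟹ 0, 0, by simp [Sequent.signed], by simp, by simp⟩
  | cons f F ih =>
    rw [List.forall_mem_cons] at hF
    obtain ⟨S, G, hS, hG, hSG⟩ := exists_provable_cons hK hF.1
    obtain ⟨T, H, hT, hH, hTH⟩ := ih hF.2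
    have signed_add : (S.ant + T.ant ⟹ S.suc + T.suc).signed = S.signed ∪ T.signed := by
      ext g
      cases g <;> simp
    refine ⟨_ ⟹ _, G + H, signed_add ▸ Set.union_subset hS hT, forall_mem_add.2 ⟨hG, hH⟩, ?_⟩
    refine List.forall_mem_cons.2 ⟨hSG.mono_cons ?_ ?_, fun g hg => (hTH g hg).mono_cons ?_ ?_⟩
    · rw [Sequent.signed_cons, Sequent.signed_cons, signed_add]
      exact Set.insert_subset_insert Set.subset_union_left
    · exact Multiset.subset_add_left
    · rw [Sequent.signed_cons, Sequent.signed_cons, signed_add]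
      exact Set.insert_subset_insert Set.subset_union_right
    · exact Multiset.subset_add_right

theorem exists_mem_of_rule (hK : Maximal Consistent K) {c : SignedFormula α} (hc : c ∈ w.1)
    (F : List (SignedFormula α)) (rule : ∀ (S : Sequent α) (G : Hypersequent α),
      (∀ f ∈ F, Provable ((S.cons c).cons f ::ₘ G)) → Provable (S.cons c ::ₘ G)) :
    ∃ f ∈ F, f ∈ w.1 := by
  by_contra! hF
  obtain ⟨S, G, hS, hG, hSG⟩ := exists_forall_provable_cons hK hF
  have hSc : S.cons c ∈ K :=
    w.2.prop _ (Sequent.signed_cons ▸ Set.insert_subset hc hS)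
  refine not_provable_cons hK.prop hSc hG (rule S G fun f hf => ?_)
  refine (hSG f hf).mono_cons ?_ (Multiset.Subset.refl G)
  simp only [Sequent.signed_cons]
  exact Set.insert_subset_insert (Set.subset_insert c _)

theorem fails_var_notMem (hK : Maximal Consistent K) {p : α} (hp : holds (var p) ∈ w.1) :
    fails (var p) ∉ w.1 := by
  intro hp'
  have hmem : ({var p} ⟹ {var p}) ∈ K := w.2.prop _ (by simp [Sequent.signed_subset_iff, hp, hp'])
  exact not_provable_cons hK.prop hmem (G := 0) (by simp) ⟨.ax p 0 0 0, trivial⟩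

theorem fails_of_holds_neg (hK : Maximal Consistent K) (h : holds (neg A) ∈ w.1) :
    fails A ∈ w.1 := by
  suffices ∃ f ∈ [fails A], f ∈ w.1 by simpa using this
  refine exists_mem_of_rule hK h _ fun S G hrule => ?_
  obtain ⟨d, hd⟩ := hrule (fails A) (by simp)
  exact ⟨.contrL (.negL d), hd⟩

theorem holds_of_fails_neg (hK : Maximal Consistent K) (h : fails (neg A) ∈ w.1) :
    holds A ∈ w.1 := by
  suffices ∃ f ∈ [holds A], f ∈ w.1 by simpa using this
  refine exists_mem_of_rule hK h _ fun S G hrule => ?_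
  obtain ⟨d, hd⟩ := hrule (holds A) (by simp)
  exact ⟨.contrR (.negR d), hd⟩

theorem fails_or_holds_of_holds_imp (hK : Maximal Consistent K) (h : holds (imp A B) ∈ w.1) :
    fails A ∈ w.1 ∨ holds B ∈ w.1 := by
  suffices ∃ f ∈ [fails A, holds B], f ∈ w.1 by simpa using this
  refine exists_mem_of_rule hK h _ fun S G hrule => ?_
  obtain ⟨d₁, hd₁⟩ := hrule (fails A) (by simp)
  obtain ⟨d₂, hd₂⟩ := hrule (holds B) (by simp)
  exact ⟨.contrL (.impL d₁ d₂), hd₁, hd₂⟩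

theorem holds_of_fails_imp (hK : Maximal Consistent K) (h : fails (imp A B) ∈ w.1) :
    holds A ∈ w.1 := by
  suffices ∃ f ∈ [holds A], f ∈ w.1 by simpa using this
  refine exists_mem_of_rule hK h _ fun S G hrule => ?_
  obtain ⟨d, hd⟩ := hrule (holds A) (by simp)
  exact ⟨.contrR (.impR (.weakR d)), hd⟩

theorem fails_of_fails_imp (hK : Maximal Consistent K) (h : fails (imp A B) ∈ w.1) :
    fails B ∈ w.1 := by
  suffices ∃ f ∈ [fails B], f ∈ w.1 by simpa using this
  refine exists_mem_of_rule hK h _ fun S G hrule => ?_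
  obtain ⟨d, hd⟩ := hrule (fails B) (by simp)
  exact ⟨.contrR (.impR (.weakL d)), hd⟩

theorem holds_of_holds_box (hK : Maximal Consistent K) (h : holds (box A) ∈ w.1) :
    holds A ∈ w.1 := by
  suffices ∃ f ∈ [holds A], f ∈ w.1 by simpa using this
  refine exists_mem_of_rule hK h _ fun S G hrule => ?_
  obtain ⟨d, hd⟩ := hrule (holds A) (by simp)
  exact ⟨.boxL d, hd⟩

theorem fails_or_fails_bet_or_holds_of_holds_obl (hK : Maximal Consistent K)
    (h : holds (obl B A) ∈ w.1) :
    fails A ∈ w.1 ∨ fails (bet (neg A)) ∈ w.1 ∨ holds B ∈ w.1 := by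
  suffices ∃ f ∈ [fails A, fails (bet (neg A)), holds B], f ∈ w.1 by simpa using this
  refine exists_mem_of_rule hK h _ fun S G hrule => ?_
  obtain ⟨d₁, hd₁⟩ := hrule (fails A) (by simp)
  obtain ⟨d₂, hd₂⟩ := hrule (fails (bet (neg A))) (by simp)
  obtain ⟨d₃, hd₃⟩ := hrule (holds B) (by simp)
  exact ⟨.oblL d₁ d₂ d₃, hd₁, hd₂, hd₃⟩

theorem holds_of_holds_of_isBox_or_isObl (hK : Maximal Consistent K)
    (hA : A.isBox = true ∨ A.isObl = true) (h : holds A ∈ w.1) (v : World K) : holds A ∈ v.1 := by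
  by_contra hv
  obtain ⟨S, G, hS, hG, hSG⟩ := exists_provable_cons hK hv
  have hmem : A ∈ boxPart {A} + oblPart {A} :=
    mem_boxPart_add_oblPart.2 ⟨Multiset.mem_singleton_self A, hA⟩
  obtain ⟨d, hd⟩ : Provable ((boxPart {A} + oblPart {A} + S.ant ⟹ S.suc) ::ₘ G) := by
    refine hSG.mono_cons ?_ (Multiset.Subset.refl G)
    rw [Sequent.signed_cons, Set.insert_subset_iff, Sequent.signed_subset_iff]
    simp +contextual [Multiset.mem_add (s := _ + _), hmem]
  have hAK : ({A} ⟹ 0) ∈ K := w.2.prop _ (by simp [Sequent.signed_subset_iff, h])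
  exact not_provable_cons hK.prop hAK (Multiset.forall_mem_cons.2 ⟨v.2.prop S hS, hG⟩) ⟨.s5 d, hd⟩

theorem exists_fails_of_fails_box (hK : Maximal Consistent K) (h : fails (box A) ∈ w.1) :
    ∃ v : World K, fails A ∈ v.1 := by
  suffices ∃ v : World K, {fails A} ⊆ v.1 by simpa using this
  refine exists_world_of_rule hK w fun S G hS hSG => ?_
  obtain ⟨d, hd⟩ : Provable ((boxPart 0 + oblPart 0 ⟹ {A}) ::ₘ G) :=
    hSG.mono_cons (hS.trans (by simp)) (Multiset.Subset.refl G)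
  exact ⟨0 ⟹ {box A}, by simp [Sequent.signed_subset_iff, h], .boxR d, hd⟩

theorem exists_best_of_fails_obl (hK : Maximal Consistent K) (h : fails (obl B A) ∈ w.1) :
    ∃ v : World K, holds A ∈ v.1 ∧ holds (bet (neg A)) ∈ v.1 ∧ fails B ∈ v.1 := by
  suffices ∃ v : World K, {holds A, holds (bet (neg A)), fails B} ⊆ v.1 by
    simpa [Set.insert_subset_iff] using this
  refine exists_world_of_rule hK w fun S G hS hSG => ?_
  obtain ⟨d, hd⟩ : Provable ((A ::ₘ bet (neg A) ::ₘ (boxPart 0 + oblPart 0) ⟹ {B}) ::ₘ G) :=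
    hSG.mono_cons (hS.trans (by simp [Set.insert_subset_iff])) (Multiset.Subset.refl G)
  exact ⟨0 ⟹ {obl B A}, by simp [Sequent.signed_subset_iff, h], .oblR d, hd⟩

theorem exists_better_of_fails_bet (hK : Maximal Consistent K) (h : fails (bet A) ∈ w.1) :
    ∃ v : World K, (∀ B, holds (bet B) ∈ w.1 → holds B ∈ v.1) ∧ fails A ∈ v.1 := by
  suffices ∃ v : World K, insert (fails A) (holds '' {B | holds (bet B) ∈ w.1}) ⊆ v.1 by
    obtain ⟨v, hv⟩ := this
    exact ⟨v, fun B hB => hv (.inr ⟨B, hB, rfl⟩), hv (.inl rfl)⟩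
  refine exists_world_of_rule hK w fun S G hS hSG => ?_
  obtain ⟨hant, hsuc⟩ : (∀ B ∈ S.ant, holds (bet B) ∈ w.1) ∧ ∀ B ∈ S.suc, B = A := by
    simpa [Sequent.signed_subset_iff] using hS
  obtain ⟨d, hd⟩ : Provable ((boxPart (S.ant.map bet) + oblPart (S.ant.map bet) +
      betPart (S.ant.map bet) ⟹ {A}) ::ₘ G) := by
    refine hSG.mono_cons ?_ (Multiset.Subset.refl G)
    simpa +contextual [Sequent.signed_subset_iff, Multiset.mem_add (s := _ + _), mem_betPart]
      using hsuc
  exact ⟨S.ant.map bet ⟹ {bet A}, by simpa [Sequent.signed_subset_iff, h] using hant, .betR d, hd⟩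

end World

/-- The worlds are ordered by the `bet`-formulas that hold at them, as in normal modal logic. -/
def canonicalModel (K : Set (Sequent α)) : Model.{u, u} α where
  World := World K
  better w v := ∀ A, holds (bet A) ∈ w.1 → holds A ∈ v.1
  val w p := holds (var p) ∈ w.1

theorem canonicalModel_sat (hK : Maximal Consistent K) (A : Formula α) (w : World K) :
    (holds A ∈ w.1 → (canonicalModel K).Sat w A) ∧
      (fails A ∈ w.1 → ¬ (canonicalModel K).Sat w A) := by
  induction A generalizing w with
  | var p => exact ⟨id, fun h h' => World.fails_var_notMem hK h' h⟩
  | neg A ih =>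
    exact ⟨fun h => (ih w).2 (World.fails_of_holds_neg hK h),
      fun h => not_not.2 ((ih w).1 (World.holds_of_fails_neg hK h))⟩
  | imp A B ihA ihB =>
    refine ⟨fun h hA => ?_, fun h hAB => ?_⟩
    · rcases World.fails_or_holds_of_holds_imp hK h with h | h
      · exact absurd hA ((ihA w).2 h)
      · exact (ihB w).1 h
    · exact (ihB w).2 (World.fails_of_fails_imp hK h)
        (hAB ((ihA w).1 (World.holds_of_fails_imp hK h)))
  | box A ih =>
    refine ⟨fun h v => ?_, fun h hA => ?_⟩
    · have hv := World.holds_of_holds_of_isBox_or_isObl hK (.inl rfl) h v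
      exact (ih v).1 (World.holds_of_holds_box hK hv)
    · obtain ⟨v, hv⟩ := World.exists_fails_of_fails_box hK h
      exact (ih v).2 hv (hA v)
  | obl B A ihB ihA =>
    refine ⟨fun h v hA hbest => ?_, fun h hobl => ?_⟩
    · have hv := World.holds_of_holds_of_isBox_or_isObl hK (.inr rfl) h v
      rcases World.fails_or_fails_bet_or_holds_of_holds_obl hK hv with hv | hv | hv
      · exact absurd hA ((ihA v).2 hv)
      · obtain ⟨u, hvu, hu⟩ := World.exists_better_of_fails_bet hK hv
        exact absurd ((ihA u).1 (World.holds_of_fails_neg hK hu)) (hbest u hvu)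
      · exact (ihB v).1 hv
    · obtain ⟨v, hA, hbest, hB⟩ := World.exists_best_of_fails_obl hK h
      refine (ihB v).2 hB (hobl v ((ihA v).1 hA) fun u hvu => ?_)
      exact (ihA u).2 (World.fails_of_holds_neg hK (hvu _ hbest))
  | bet A ih =>
    refine ⟨fun h v hwv => (ih v).1 (hwv A h), fun h hbet => ?_⟩
    obtain ⟨v, hwv, hv⟩ := World.exists_better_of_fails_bet hK h
    exact (ih v).2 hv (hbet v hwv)

theorem subset_theory_canonicalModel (hK : Maximal Consistent K) (w : World K) :
    w.1 ⊆ (canonicalModel K).theory w := by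
  rintro (A | A) hA
  · exact holds_mem_theory.2 ((canonicalModel_sat hK A w).1 hA)
  · exact fails_mem_theory.2 ((canonicalModel_sat hK A w).2 hA)

theorem provable_of_forall_not_refutes (h : ∀ M : Model.{u, u} α, ¬ M.Refutes H) :
    Provable H := by
  by_contra hH
  have hconsistent : Consistent {S | S ∈ H} := fun G hG hGprov => hH (hGprov.mono hG)
  obtain ⟨K, hHK, hK⟩ := hconsistent.exists_maximal
  refine h (canonicalModel K) fun S hS => ?_
  obtain ⟨w, hw⟩ := (coherent_signed hK (hHK hS)).exists_world
  exact ⟨w, hw.trans (subset_theory_canonicalModel hK w)⟩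

end HE

theorem mainTheorem1 {α : Type u} :
    (∀ (H : HE.Hypersequent α) (_ : HE.Proof H), ∃ d : HE.Proof H, d.CutFree) ∧
    (∀ (H : HE.Hypersequent α) (d : HE.Proof H), d.CutFree →
      ∀ B : HE.Formula α, d.Occurs B →
        ∃ A : HE.Formula α, H.Contains A ∧ B.IsRelaxedSubformula A) := by
  refine ⟨fun H d => HE.provable_of_forall_not_refutes d.not_refutes, fun H d hd B hB => ?_⟩
  exact hd.mem_of_occurs (HE.relaxedClosed_setOf_isRelaxedSubformula {A | H.Contains A})
    (fun A hA => ⟨A, hA, .inl .refl⟩) hB
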